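/- Let $p\in\mathbb N$, let $S\in\mathbb R^{p\times p}$ be a symmetric positive semidefinite matrix (a sample covariance matrix) with $S_{ij}<\sqrt{S_{ii}S_{jj}}$ for all $i\neq j$, and let $\Lambda\in\mathbb R^{p\times p}$ be a symmetric matrix with $\Lambda_{ij}\ge 0$ for all $i\ne j$. Let $\mathcal M^p$ be the set of symmetric positive definite $p\times p$ real matrices $\Theta$ with $\Theta_{ij}\le 0$ for all $i\ne j$, and let $\Theta^\star$ be an optimal solution of $$\min_{\Theta\in\mathcal M^p}\ -\log\det\Theta+\langle\Theta,S\rangle+\sum_{i\ne j}\Lambda_{ij}|\Theta_{ij}| .$$ Let $T\in\mathbb R^{p\times p}$ be the thresholded matrix given by $T_{ij}=S_{ij}-\Lambda_{ij}$ if $i\neq j$ and $S_{ij}>\Lambda_{ij}$, and $T_{ij}=0$ otherwise. For a symmetric matrix $A\in\mathbb R^{p\times p}$ let $\mathrm{supp}(A)$ be the undirected graph on $\{1,\dots,p\}$ in which two different vertices $i,j$ are adjacent if and only if $A_{ij}\ne 0$. An edge of a graph is called a bridge if its deletion increases the number of connected components. If $(i,j)$ is a bridge of $\mathrm{supp}(T)$,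 then $(i,j)$ is an edge, and indeed a bridge, of $\mathrm{supp}(\Theta^\star)$, and $$\Theta^\star_{ij}=-\frac{T_{ij}}{S_{ii}S_{jj}-T_{ij}^2}\neq 0 .$$ -/

import Mathlib

noncomputable section

namespace MTP2

/-- The support graph of a symmetric matrix `A`: vertices `0, …, p - 1`, with an edge between two
different vertices `i`, `j` iff `A i j ≠ 0`. (`SimpleGraph.fromRel` removes the loops; for symmetric
`A` the relation `A i j ≠ 0` is already symmetric.) -/
def suppGraph {p : ℕ} (A : Matrix (Fin p) (Fin p) ℝ) : SimpleGraph (Fin p) :=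
  SimpleGraph.fromRel fun i j => A i j ≠ 0

/-- `(i, j)` is a bridge of `G`: it is an edge of `G`, and deleting it disconnects `i` from `j`
(equivalently, increases the number of components). Mathlib's `SimpleGraph.IsBridge` alone does not
ask for an edge. -/
def IsBridgeEdge {V : Type*} (G : SimpleGraph V) (i j : V) : Prop :=
  G.Adj i j ∧ G.IsBridge s(i, j)

/-- The set of symmetric positive definite matrices with nonpositive off-diagonal entries. -/
def mMatrices (p : ℕ) : Set (Matrix (Fin p) (Fin p) ℝ) :=
  {Θ | Θ.PosDef ∧ ∀ i j, i ≠ j → Θ i j ≤ 0}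

/-- The objective `-log det Θ + ⟨Θ, S⟩ + ∑_{i ≠ j} Λ_{ij} |Θ_{ij}|`. -/
def objective {p : ℕ} (S Λ Θ : Matrix (Fin p) (Fin p) ℝ) : ℝ :=
  -Real.log Θ.det + (∑ i, ∑ j, Θ i j * S i j)
    + ∑ i, ∑ j, if i ≠ j then Λ i j * |Θ i j| else 0

/-- `Θ` is an optimal solution of the problem of minimizing `objective S Λ` over `mMatrices p`. -/
def IsOptimal {p : ℕ} (S Λ Θ : Matrix (Fin p) (Fin p) ℝ) : Prop :=
  Θ ∈ mMatrices p ∧ IsMinOn (objective S Λ) (mMatrices p) Θ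

/-- The thresholded sample covariance matrix. -/
def thresholded {p : ℕ} (S Λ : Matrix (Fin p) (Fin p) ℝ) : Matrix (Fin p) (Fin p) ℝ :=
  Matrix.of fun i j => if i ≠ j ∧ Λ i j < S i j then S i j - Λ i j else 0

end MTP2

end

/-!
For `Θ ∈ mMatrices p` all off-diagonal entries are nonpositive, so the penalty is linear there and
the objective is `-log det Θ + ⟨Θ, C⟩` with `C = effectiveCov S Λ`. Write `W = Θ⁻¹` for an optimal
`Θ`. Moving `Θ` along the symmetric matrices supported on `(i, j)` and `(j, i)` gives the
first-order conditions `W i i = S i i` and `C i j ≤ W i j`, with equality when `Θ i j < 0`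
(`effectiveCov_le_inv`, `effectiveCov_eq_inv`).

The inverse of a positive definite matrix with nonpositive off-diagonal entries is entrywise
nonnegative, and positive where `Θ i j < 0` (`inv_nonneg_of_offDiag_nonpos`,
`inv_pos_of_entry_neg`). Together with the first-order conditions this shows that every edge of
`supp Θ` is an edge of `supp T`, where `T` is the thresholded matrix, and that `T i j ≤ W i j`.

If `(i, j)` is a bridge of `supp T`, the vertices still reachable from `i` after its deletion form a
cut which `(i, j)` is the only edge of `supp Θ` to cross. For such a cut,
`Θ i j * (W i i * W j j - W i j ^ 2) = -W i j` (`mul_minor_inv_of_unique_cut_edge`). As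
`W i j ≥ T i j > 0`, this forces `Θ i j < 0`, hence `W i j = T i j`, and the formula follows.
-/

namespace MTP2

open Matrix Filter Topology

/-! ### Symmetric perturbations of a positive definite matrix -/

section PosDef

variable {n : Type*} [Fintype n] [DecidableEq n]

/-- The symmetric matrix `c (eᵢ eⱼᵀ + eⱼ eᵢᵀ)`; for `i = j` its only entry is `2 c`. -/
def symmSingle (i j : n) (c : ℝ) : Matrix n n ℝ :=
  Matrix.single i j c + Matrix.single j i c

omit [Fintype n] in
lemma symmSingle_isHermitian (i j : n) (c : ℝ) : (symmSingle i j c).IsHermitian := by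
  simp [symmSingle, Matrix.IsHermitian, add_comm]

lemma dotProduct_symmSingle_mulVec (i j : n) (c : ℝ) (x : n → ℝ) :
    x ⬝ᵥ (symmSingle i j c *ᵥ x) = 2 * c * (x i * x j) := by
  simp [symmSingle, Matrix.add_mulVec, Matrix.single_mulVec, dotProduct, Function.update_apply,
    mul_add, Finset.sum_add_distrib]
  ring

lemma _root_.Matrix.PosDef.mul_inv_self {Θ : Matrix n n ℝ} (hΘ : Θ.PosDef) : Θ * Θ⁻¹ = 1 :=
  Matrix.mul_nonsing_inv _ (Matrix.isUnit_iff_isUnit_det _ |>.1 hΘ.isUnit)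

lemma _root_.Matrix.PosDef.inv_apply_comm {Θ : Matrix n n ℝ} (hΘ : Θ.PosDef) (i j : n) :
    Θ⁻¹ i j = Θ⁻¹ j i := by
  simpa using (hΘ.inv.isHermitian.apply i j).symm

/-- Coordinates are controlled by the quadratic form: the case of the Cauchy-Schwarz inequality for
the form of `Θ` applied to `x` and to the `k`-th column of `Θ⁻¹`. -/
lemma _root_.Matrix.PosDef.sq_apply_le {Θ : Matrix n n ℝ} (hΘ : Θ.PosDef) (x : n → ℝ) (k : n) :
    x k ^ 2 ≤ Θ⁻¹ k k * (x ⬝ᵥ (Θ *ᵥ x)) := by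
  have hWk : 0 < Θ⁻¹ k k := hΘ.inv.diag_pos
  set w : n → ℝ := Θ⁻¹.col k with hw
  have hΘw : Θ *ᵥ w = Pi.single k 1 := by
    rw [hw, ← Matrix.mulVec_single_one, Matrix.mulVec_mulVec, hΘ.mul_inv_self, Matrix.one_mulVec]
  have hsymm : w ⬝ᵥ (Θ *ᵥ x) = x k := by
    rw [Matrix.dotProduct_mulVec, ← Matrix.mulVec_transpose]
    have : Θᵀ = Θ := by simpa [Matrix.IsHermitian] using hΘ.isHermitian
    rw [this, hΘw]; simp
  have key := hΘ.posSemidef.dotProduct_mulVec_nonneg (Θ⁻¹ k k • x - x k • w)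
  have hwk : w k = Θ⁻¹ k k := rfl
  simp only [star_trivial, Matrix.mulVec_sub, Matrix.mulVec_smul, hΘw, sub_dotProduct,
    dotProduct_sub, smul_dotProduct, dotProduct_smul, smul_eq_mul, hsymm,
    dotProduct_single_one, Pi.sub_apply, Pi.smul_apply, hwk] at key
  have hprod : 0 ≤ Θ⁻¹ k k * (Θ⁻¹ k k * (x ⬝ᵥ (Θ *ᵥ x)) - x k ^ 2) := by linarith
  linarith [nonneg_of_mul_nonneg_right hprod hWk]

lemma _root_.Matrix.PosDef.eventually_add_smul_symmSingle {Θ : Matrix n n ℝ} (hΘ : Θ.PosDef)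
    (i j : n) (c : ℝ) : ∀ᶠ t : ℝ in 𝓝 0, (Θ + t • symmSingle i j c).PosDef := by
  have hlim : Tendsto (fun t : ℝ => |t * c| * (Θ⁻¹ i i + Θ⁻¹ j j)) (𝓝 0) (𝓝 0) := by
    have : Continuous fun t : ℝ => |t * c| * (Θ⁻¹ i i + Θ⁻¹ j j) := by fun_prop
    simpa using this.tendsto 0
  filter_upwards [hlim.eventually_lt_const one_pos] with t ht
  refine Matrix.PosDef.of_dotProduct_mulVec_pos ?_ fun x hx => ?_
  · refine hΘ.isHermitian.add ?_
    rw [Matrix.IsHermitian, Matrix.conjTranspose_smul, star_trivial,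
      (symmSingle_isHermitian i j c).eq]
  · have hq := hΘ.dotProduct_mulVec_pos hx
    have hi := hΘ.sq_apply_le x i
    have hj := hΘ.sq_apply_le x j
    simp only [star_trivial] at hq ⊢
    rw [Matrix.add_mulVec, dotProduct_add, Matrix.smul_mulVec, dotProduct_smul,
      dotProduct_symmSingle_mulVec, smul_eq_mul]
    have h1 : |2 * (x i * x j)| ≤ x i ^ 2 + x j ^ 2 := by
      rw [abs_le]
      constructor <;> nlinarith [sq_nonneg (x i + x j), sq_nonneg (x i - x j)]
    have h2 : |t * c * (2 * (x i * x j))| ≤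
        |t * c| * ((Θ⁻¹ i i + Θ⁻¹ j j) * (x ⬝ᵥ (Θ *ᵥ x))) := by
      rw [abs_mul]
      exact mul_le_mul_of_nonneg_left (h1.trans (by linarith)) (abs_nonneg _)
    have h3 := neg_abs_le (t * c * (2 * (x i * x j)))
    nlinarith [mul_lt_mul_of_pos_right ht hq]

lemma _root_.Matrix.PosDef.hasDerivAt_log_det {Θ : Matrix n n ℝ} (hΘ : Θ.PosDef)
    (E : Matrix n n ℝ) :
    HasDerivAt (fun t : ℝ => Real.log (Θ + t • E).det) (Θ⁻¹ * E).trace 0 := by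
  have hdet : ∀ t : ℝ, (Θ + t • E).det = Θ.det * (1 + t • (Θ⁻¹ * E)).det := fun t => by
    rw [← Matrix.det_mul, mul_add, mul_one, Matrix.mul_smul, ← mul_assoc, hΘ.mul_inv_self, one_mul]
  have h1 : HasDerivAt (fun t : ℝ => (1 + t • (Θ⁻¹ * E)).det) (Θ⁻¹ * E).trace 0 := by
    rw [funext fun t : ℝ => Matrix.det_one_add_smul t (Θ⁻¹ * E)]
    set q := (1 + (Polynomial.X : Polynomial ℝ) • (Θ⁻¹ * E).map Polynomial.C).det.divX.divX
    have := (((hasDerivAt_id (0 : ℝ)).const_mul (Θ⁻¹ * E).trace).const_add 1).add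
      ((q.hasDerivAt 0).mul ((hasDerivAt_id (0 : ℝ)).pow 2))
    convert! this using 1
    simp
  simp_rw [hdet]
  have h2 := (h1.const_mul Θ.det).log (by simpa using hΘ.det_pos.ne')
  convert! h2 using 1
  simp [hΘ.det_pos.ne']

/-! ### Inverses of positive definite matrices with nonpositive off-diagonal entries -/

/-- Testing `Θ w = e_j`, for `w` the `j`-th column of `Θ⁻¹`, against the negative part of `w` shows
that the negative part vanishes. -/
lemma inv_nonneg_of_offDiag_nonpos {Θ : Matrix n n ℝ} (hΘ : Θ.PosDef)
    (hoff : ∀ i j, i ≠ j → Θ i j ≤ 0) (i j : n) : 0 ≤ Θ⁻¹ i j := by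
  set w : n → ℝ := Θ⁻¹.col j with hw
  set m : n → ℝ := fun k => max (-w k) 0 with hm
  have hm0 : ∀ k, 0 ≤ m k := fun k => le_max_right _ _
  have hΘw : Θ *ᵥ w = Pi.single j 1 := by
    rw [hw, ← Matrix.mulVec_single_one, Matrix.mulVec_mulVec, hΘ.mul_inv_self, Matrix.one_mulVec]
  have hmw : 0 ≤ m ⬝ᵥ (Θ *ᵥ w) := by simpa [hΘw] using hm0 j
  have hcross : m ⬝ᵥ (Θ *ᵥ (w + m)) ≤ 0 := by
    refine Finset.sum_nonpos fun a _ => ?_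
    rw [Matrix.mulVec, dotProduct, Finset.mul_sum]
    refine Finset.sum_nonpos fun b _ => ?_
    have hb : 0 ≤ (w + m) b := by
      have := le_max_left (-w b) 0
      simp only [Pi.add_apply, hm]; linarith
    by_cases hab : a = b
    · -- `m` and `w + m` are the negative and positive parts, so one of them vanishes at `a`.
      subst hab
      have : m a * (w + m) a = 0 := by
        simp only [Pi.add_apply, hm]
        rcases le_total (-w a) 0 with h | h
        · rw [max_eq_right h]; ring
        · rw [max_eq_left h]; ring
      exact le_of_eq (by linear_combination Θ a a * this)
    · exact mul_nonpos_of_nonneg_of_nonpos (hm0 a)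
        (mul_nonpos_of_nonpos_of_nonneg (hoff a b hab) hb)
  have hm_zero : m = 0 := by
    by_contra hne
    have := hΘ.dotProduct_mulVec_pos hne
    rw [Matrix.mulVec_add, dotProduct_add] at hcross
    simp only [star_trivial] at this
    linarith
  have := congrFun hm_zero i
  simp only [hm, Pi.zero_apply, max_eq_right_iff] at this
  change 0 ≤ w i
  linarith

lemma inv_pos_of_entry_neg {Θ : Matrix n n ℝ} (hΘ : Θ.PosDef)
    (hoff : ∀ i j, i ≠ j → Θ i j ≤ 0) {i j : n} (hne : i ≠ j) (hij : Θ i j < 0) :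
    0 < Θ⁻¹ i j := by
  have h0 : ∑ k, Θ i k * Θ⁻¹ k j = 0 := by
    rw [← Matrix.mul_apply, hΘ.mul_inv_self, Matrix.one_apply_ne hne]
  refine (inv_nonneg_of_offDiag_nonpos hΘ hoff i j).lt_of_ne' fun hz => ?_
  have hneg : ∑ k, Θ i k * Θ⁻¹ k j < 0 := by
    refine Finset.sum_neg' (fun k _ => ?_) ⟨j, Finset.mem_univ _, ?_⟩
    · by_cases hk : i = k
      · subst hk; simp [hz]
      · exact mul_nonpos_of_nonpos_of_nonneg (hoff i k hk)
          (inv_nonneg_of_offDiag_nonpos hΘ hoff k j)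
    · exact mul_neg_of_neg_of_pos hij hΘ.inv.diag_pos
  exact hneg.ne h0

/-- Positivity of the quadratic form of `A` at `A j j eᵢ - A i j eⱼ`. -/
lemma sq_apply_lt_mul_diag {A : Matrix n n ℝ} (hA : A.PosDef) {i j : n} (hne : i ≠ j) :
    A i j ^ 2 < A i i * A j j := by
  have hsymm : A j i = A i j := by simpa using hA.isHermitian.apply i j
  have hjj : 0 < A j j := hA.diag_pos
  have hx : (Pi.single i (A j j) - Pi.single j (A i j) : n → ℝ) ≠ 0 := fun h => by
    have := congrFun h i
    simp [hne] at this
    exact hjj.ne' this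
  have key := hA.dotProduct_mulVec_pos hx
  simp [Matrix.mulVec_sub, sub_dotProduct, dotProduct_sub, hsymm] at key
  nlinarith

/-! ### Cuts crossed by a single edge -/

/-- If `(i, j)` carries the only nonzero entry of `Θ` between `A` and its complement, then
`Θ i j` is determined by the principal submatrix of `Θ⁻¹` on `{i, j}`. -/
lemma mul_minor_inv_of_unique_cut_edge {Θ : Matrix n n ℝ} (hΘ : Θ.PosDef) {A : Set n} {i j : n}
    (hi : i ∈ A) (hj : j ∉ A) (hcut : ∀ a ∈ A, ∀ b ∉ A, Θ a b ≠ 0 → a = i ∧ b = j) :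
    Θ i j * (Θ⁻¹ i i * Θ⁻¹ j j - Θ⁻¹ i j ^ 2) = -Θ⁻¹ i j := by
  classical
  set W := Θ⁻¹ with hW
  set θ := Θ i j with hθ
  have hji : W j i = W i j := hΘ.inv_apply_comm j i
  -- The block of `Θ` on `A` maps columns `i` and `j` of `W`, restricted to `A`, to multiples of
  -- `eᵢ`; this combination of them is annihilated, hence zero.
  set v : n → ℝ := fun a => if a ∈ A then θ * W j j * W a i + (1 - θ * W i j) * W a j else 0
    with hv
  have hcol : ∀ a ∈ A, ∀ k, ∑ b, Θ a b * (if b ∈ A then W b k else 0) =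
      (1 : Matrix n n ℝ) a k - if a = i then θ * W j k else 0 := by
    intro a ha k
    rw [← hΘ.mul_inv_self, Matrix.mul_apply, eq_sub_iff_add_eq]
    have hout : (if a = i then θ * W j k else 0) = ∑ b, if b ∈ A then 0 else Θ a b * W b k := by
      rw [Finset.sum_eq_single j]
      · by_cases hai : a = i
        · simp [hai, hj, hθ]
        · have : Θ a j = 0 := by_contra fun h => hai (hcut a ha j hj h).1
          simp [hai, this]
      · intro b _ hbj
        by_cases hb : b ∈ A
        · simp [hb]
        · have : Θ a b = 0 := by_contra fun h => hbj (hcut a ha b hb h).2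
          simp [this]
      · simp
    rw [hout, ← Finset.sum_add_distrib]
    refine Finset.sum_congr rfl fun b _ => ?_
    by_cases hb : b ∈ A <;> simp [hb, hW]
  have hΘv : ∀ a ∈ A, (Θ *ᵥ v) a = 0 := by
    intro a ha
    have hsplit : (Θ *ᵥ v) a = θ * W j j * (∑ b, Θ a b * (if b ∈ A then W b i else 0)) +
        (1 - θ * W i j) * ∑ b, Θ a b * (if b ∈ A then W b j else 0) := by
      rw [Matrix.mulVec, dotProduct, Finset.mul_sum, Finset.mul_sum, ← Finset.sum_add_distrib]
      refine Finset.sum_congr rfl fun b _ => ?_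
      by_cases hb : b ∈ A
      · simp only [hv, hb, if_true]; ring
      · simp [hv, hb]
    have haj : a ≠ j := fun h => hj (h ▸ ha)
    rw [hsplit, hcol a ha, hcol a ha, Matrix.one_apply_ne haj, hji]
    by_cases hai : a = i
    · subst hai; simp only [Matrix.one_apply_eq, if_true]; ring
    · simp [hai]
  have hv0 : v = 0 := by
    by_contra hne
    have hpos := hΘ.dotProduct_mulVec_pos hne
    have : star v ⬝ᵥ (Θ *ᵥ v) = 0 := by
      refine Finset.sum_eq_zero fun a _ => ?_
      by_cases ha : a ∈ A
      · rw [hΘv a ha, mul_zero]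
      · simp [hv, ha]
    exact hpos.ne' this
  have := congrFun hv0 i
  simp only [hv, hi, if_true, Pi.zero_apply] at this
  linarith

end PosDef

/-! ### First-order optimality conditions -/

variable {p : ℕ}

/-- The matrix `C` for which the objective is `-log det Θ + ⟨Θ, C⟩` on `mMatrices p`. -/
def effectiveCov (S Λ : Matrix (Fin p) (Fin p) ℝ) : Matrix (Fin p) (Fin p) ℝ :=
  Matrix.of fun i j => if i ≠ j then S i j - Λ i j else S i j

lemma effectiveCov_comm {S Λ : Matrix (Fin p) (Fin p) ℝ} (hS : S.IsHermitian) (hΛ : Λ.IsSymm)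
    (i j : Fin p) : effectiveCov S Λ i j = effectiveCov S Λ j i := by
  have h1 : S j i = S i j := by simpa using hS.apply i j
  have h2 : Λ j i = Λ i j := hΛ.apply i j
  simp only [effectiveCov, Matrix.of_apply, h1, h2, ne_comm]

lemma objective_eq {S Λ Θ : Matrix (Fin p) (Fin p) ℝ} (hΘ : Θ ∈ mMatrices p) :
    objective S Λ Θ = -Real.log Θ.det + ∑ i, ∑ j, Θ i j * effectiveCov S Λ i j := by
  rw [objective, add_assoc, ← Finset.sum_add_distrib]
  congr 1
  refine Finset.sum_congr rfl fun i _ => ?_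
  rw [← Finset.sum_add_distrib]
  refine Finset.sum_congr rfl fun j _ => ?_
  by_cases h : i = j
  · simp [effectiveCov, h]
  · simp only [effectiveCov, Matrix.of_apply, ne_eq, h, not_false_eq_true, if_true,
      abs_of_nonpos (hΘ.2 i j h)]
    ring

lemma sum_symmSingle_mul (i j : Fin p) (c : ℝ) (C : Matrix (Fin p) (Fin p) ℝ) :
    ∑ a, ∑ b, symmSingle i j c a b * C a b = c * (C i j + C j i) := by
  simp [symmSingle, add_mul, Finset.sum_add_distrib, Matrix.single_apply, ite_and, mul_add]

lemma trace_mul_symmSingle (i j : Fin p) (c : ℝ) (W : Matrix (Fin p) (Fin p) ℝ) :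
    (W * symmSingle i j c).trace = c * (W i j + W j i) := by
  simp [symmSingle, mul_add, Matrix.trace_mul_single]
  ring

lemma IsOptimal.trace_le {S Λ Θ E : Matrix (Fin p) (Fin p) ℝ} (hΘ : IsOptimal S Λ Θ)
    (hE : ∀ᶠ t : ℝ in 𝓝[>] 0, Θ + t • E ∈ mMatrices p) :
    (Θ⁻¹ * E).trace ≤ ∑ a, ∑ b, E a b * effectiveCov S Λ a b := by
  set C := effectiveCov S Λ
  set L : ℝ := ∑ a, ∑ b, E a b * C a b with hL
  have hd : HasDerivAt (fun t : ℝ => -Real.log (Θ + t • E).det + t * L)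
      (-(Θ⁻¹ * E).trace + L) 0 := by
    simpa using! (hΘ.1.1.hasDerivAt_log_det E).neg.add ((hasDerivAt_id (0 : ℝ)).mul_const L)
  have hslope := (hasDerivWithinAt_iff_tendsto_slope' (Set.self_notMem_Ioi (a := (0 : ℝ)))).1
    (hd.hasDerivWithinAt (s := Set.Ioi 0))
  have : 0 ≤ -(Θ⁻¹ * E).trace + L := by
    refine ge_of_tendsto hslope ?_
    filter_upwards [hE, self_mem_nhdsWithin] with t ht htpos
    have hmin : objective S Λ Θ ≤ objective S Λ (Θ + t • E) := hΘ.2 ht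
    rw [objective_eq hΘ.1, objective_eq ht] at hmin
    have hsum : ∑ a, ∑ b, (Θ + t • E) a b * C a b = (∑ a, ∑ b, Θ a b * C a b) + t * L := by
      simp only [hL, Finset.mul_sum, ← Finset.sum_add_distrib, Matrix.add_apply,
        Matrix.smul_apply, smul_eq_mul]
      exact Finset.sum_congr rfl fun a _ => Finset.sum_congr rfl fun b _ => by ring
    rw [hsum] at hmin
    rw [slope_def_field]
    refine div_nonneg ?_ (by simpa using (Set.mem_Ioi.1 htpos).le)
    simp only [zero_smul, add_zero, zero_mul]
    linarith
  linarith

/-- The first-order condition in direction `c (eᵢ eⱼᵀ + eⱼ eᵢᵀ)`, which is feasible if it lowers the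
entry at `(i, j)`, or if that entry is unconstrained. -/
lemma IsOptimal.mul_inv_le {S Λ Θ : Matrix (Fin p) (Fin p) ℝ} (hS : S.IsHermitian)
    (hΛ : Λ.IsSymm) (hΘ : IsOptimal S Λ Θ) {i j : Fin p} {c : ℝ}
    (hc : c ≤ 0 ∨ i = j ∨ Θ i j < 0) : c * Θ⁻¹ i j ≤ c * effectiveCov S Λ i j := by
  have hsymm : Θ j i = Θ i j := by simpa using hΘ.1.1.isHermitian.apply i j
  have hentry : ∀ᶠ t : ℝ in 𝓝[>] 0, i ≠ j → Θ i j + t * c ≤ 0 := by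
    rcases hc with hc | hc | hc
    · filter_upwards [self_mem_nhdsWithin] with t ht hne
      have := mul_nonpos_of_nonneg_of_nonpos (Set.mem_Ioi.1 ht).le hc
      linarith [hΘ.1.2 i j hne]
    · exact Eventually.of_forall fun t hne => (hne hc).elim
    · have hlim : Tendsto (fun t : ℝ => Θ i j + t * c) (𝓝 0) (𝓝 (Θ i j)) := by
        have : Continuous fun t : ℝ => Θ i j + t * c := by fun_prop
        simpa using this.tendsto 0
      filter_upwards [nhdsWithin_le_nhds (hlim.eventually_lt_const hc)] with t ht _ using ht.le
  have hfeas : ∀ᶠ t : ℝ in 𝓝[>] 0, Θ + t • symmSingle i j c ∈ mMatrices p := by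
    filter_upwards [nhdsWithin_le_nhds (hΘ.1.1.eventually_add_smul_symmSingle i j c), hentry]
      with t ht ht'
    refine ⟨ht, fun a b hab => ?_⟩
    have hab0 := hΘ.1.2 a b hab
    simp only [Matrix.add_apply, Matrix.smul_apply, symmSingle, Matrix.single_apply, smul_eq_mul]
    by_cases h1 : i = a ∧ j = b
    · obtain ⟨rfl, rfl⟩ := h1
      have h2 : ¬(j = i ∧ i = j) := fun h => hab h.2
      simpa [h2] using ht' hab
    · by_cases h2 : j = a ∧ i = b
      · obtain ⟨rfl, rfl⟩ := h2
        simpa [h1, hsymm] using ht' hab.symm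
      · simpa [h1, h2] using hab0
  have := hΘ.trace_le hfeas
  rw [trace_mul_symmSingle, sum_symmSingle_mul, ← hΘ.1.1.inv_apply_comm i j,
    ← effectiveCov_comm hS hΛ i j] at this
  linarith

lemma IsOptimal.effectiveCov_le_inv {S Λ Θ : Matrix (Fin p) (Fin p) ℝ} (hS : S.IsHermitian)
    (hΛ : Λ.IsSymm) (hΘ : IsOptimal S Λ Θ) (i j : Fin p) :
    effectiveCov S Λ i j ≤ Θ⁻¹ i j := by
  have := hΘ.mul_inv_le hS hΛ (i := i) (j := j) (c := -1) (Or.inl (by norm_num))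
  linarith

lemma IsOptimal.effectiveCov_eq_inv {S Λ Θ : Matrix (Fin p) (Fin p) ℝ} (hS : S.IsHermitian)
    (hΛ : Λ.IsSymm) (hΘ : IsOptimal S Λ Θ) {i j : Fin p} (h : i = j ∨ Θ i j < 0) :
    effectiveCov S Λ i j = Θ⁻¹ i j := by
  have := hΘ.mul_inv_le hS hΛ (c := 1) (Or.inr h)
  exact le_antisymm (hΘ.effectiveCov_le_inv hS hΛ i j) (by linarith)

/-! ### The support of an optimal solution -/

lemma thresholded_pos_of_ne_zero {S Λ : Matrix (Fin p) (Fin p) ℝ} {i j : Fin p}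
    (h : thresholded S Λ i j ≠ 0) :
    0 < thresholded S Λ i j ∧ thresholded S Λ i j = effectiveCov S Λ i j := by
  simp only [thresholded, effectiveCov, Matrix.of_apply] at h ⊢
  split_ifs at h ⊢ with h1 h2
  · exact ⟨sub_pos.2 h1.2, rfl⟩
  · exact absurd h1.1 h2
  all_goals exact absurd rfl h

lemma thresholded_ne_zero_of_effectiveCov_pos {S Λ : Matrix (Fin p) (Fin p) ℝ} {i j : Fin p}
    (hne : i ≠ j) (h : 0 < effectiveCov S Λ i j) : thresholded S Λ i j ≠ 0 := by
  simp only [thresholded, effectiveCov, Matrix.of_apply, hne, ne_eq, not_false_eq_true, if_true,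
    true_and] at h ⊢
  rw [if_pos (sub_pos.1 h)]
  exact h.ne'

lemma suppGraph_adj {A : Matrix (Fin p) (Fin p) ℝ} (hA : ∀ i j, A i j = A j i) {i j : Fin p} :
    (suppGraph A).Adj i j ↔ i ≠ j ∧ A i j ≠ 0 := by
  simp [suppGraph, SimpleGraph.fromRel_adj, hA j i]

lemma thresholded_comm {S Λ : Matrix (Fin p) (Fin p) ℝ} (hS : S.IsHermitian) (hΛ : Λ.IsSymm)
    (i j : Fin p) : thresholded S Λ i j = thresholded S Λ j i := by
  have h1 : S j i = S i j := by simpa using hS.apply i j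
  have h2 : Λ j i = Λ i j := hΛ.apply i j
  simp only [thresholded, Matrix.of_apply, h1, h2, ne_comm]

/-- Where `Θ i j < 0`, the first-order condition gives `S i j - Λ i j = Θ⁻¹ i j > 0`. -/
lemma IsOptimal.suppGraph_le {S Λ Θ : Matrix (Fin p) (Fin p) ℝ} (hS : S.IsHermitian)
    (hΛ : Λ.IsSymm) (hΘ : IsOptimal S Λ Θ) :
    suppGraph Θ ≤ suppGraph (thresholded S Λ) := by
  intro a b hab
  rw [suppGraph_adj fun i j => by simpa using (hΘ.1.1.isHermitian.apply i j).symm] at hab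
  rw [suppGraph_adj (thresholded_comm hS hΛ)]
  have hneg : Θ a b < 0 := (hΘ.1.2 a b hab.1).lt_of_ne hab.2
  refine ⟨hab.1, thresholded_ne_zero_of_effectiveCov_pos hab.1 ?_⟩
  rw [hΘ.effectiveCov_eq_inv hS hΛ (Or.inr hneg)]
  exact inv_pos_of_entry_neg hΘ.1.1 hΘ.1.2 hab.1 hneg

end MTP2

theorem corollary1 (p : ℕ) (S Λ Θ : Matrix (Fin p) (Fin p) ℝ)
    (hS : S.PosSemidef)
    (hΛsymm : Λ.IsSymm) (hΛ : ∀ i j, i ≠ j → 0 ≤ Λ i j)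
    (hassump : ∀ i j, i ≠ j → S i j < Real.sqrt (S i i * S j j))
    (hΘ : MTP2.IsOptimal S Λ Θ)
    (i j : Fin p)
    (hij : MTP2.IsBridgeEdge (MTP2.suppGraph (MTP2.thresholded S Λ)) i j) :
    (MTP2.suppGraph Θ).Adj i j ∧
      MTP2.IsBridgeEdge (MTP2.suppGraph Θ) i j ∧
      Θ i j = -(MTP2.thresholded S Λ i j) /
        (S i i * S j j - (MTP2.thresholded S Λ i j) ^ 2) ∧
      Θ i j ≠ 0 := by
  have hSh := hS.isHermitian
  have hPD := hΘ.1.1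
  have hΘsymm : ∀ a b, Θ a b = Θ b a := fun a b => by
    simpa using (hPD.isHermitian.apply a b).symm
  have hle := hΘ.suppGraph_le hSh hΛsymm
  obtain ⟨hadj, hbridge⟩ := hij
  obtain ⟨hne, hT⟩ := (MTP2.suppGraph_adj (MTP2.thresholded_comm hSh hΛsymm)).1 hadj
  obtain ⟨hTpos, hTC⟩ := MTP2.thresholded_pos_of_ne_zero hT
  set G := (MTP2.suppGraph (MTP2.thresholded S Λ)).deleteEdges {s(i, j)} with hG
  have hcut : ∀ a ∈ {a | G.Reachable i a}, ∀ b ∉ {a | G.Reachable i a}, Θ a b ≠ 0 →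
      a = i ∧ b = j := by
    intro a ha b hb hab
    have hab' : a ≠ b := fun h => hb (h ▸ ha)
    have hTadj := hle ((MTP2.suppGraph_adj hΘsymm).2 ⟨hab', hab⟩)
    have hmem : s(a, b) = s(i, j) := by
      by_contra h
      exact hb (SimpleGraph.Reachable.trans ha
        (SimpleGraph.deleteEdges_adj.2 ⟨hTadj, h⟩ : G.Adj a b).reachable)
    rcases Sym2.eq_iff.1 hmem with h | ⟨_, rfl⟩
    · exact h
    · exact (hb (SimpleGraph.Reachable.refl _)).elim
  have hkey := MTP2.mul_minor_inv_of_unique_cut_edge hPD (A := {a | G.Reachable i a})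
    (SimpleGraph.Reachable.refl _) (SimpleGraph.isBridge_iff.1 hbridge) hcut
  have hWpos : 0 < Θ⁻¹ i j :=
    (hTC ▸ hTpos).trans_le (hΘ.effectiveCov_le_inv hSh hΛsymm i j)
  have hne0 : Θ i j ≠ 0 := fun h => by
    rw [h, zero_mul] at hkey
    linarith
  have hneg : Θ i j < 0 := (hΘ.1.2 i j hne).lt_of_ne hne0
  have hminor := MTP2.sq_apply_lt_mul_diag hPD.inv hne
  have hdiag : ∀ k, Θ⁻¹ k k = S k k := fun k => by
    rw [← hΘ.effectiveCov_eq_inv hSh hΛsymm (Or.inl rfl)]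
    simp [MTP2.effectiveCov]
  rw [← hΘ.effectiveCov_eq_inv hSh hΛsymm (Or.inr hneg), ← hTC, hdiag, hdiag] at hkey hminor
  have hΘadj : (MTP2.suppGraph Θ).Adj i j := (MTP2.suppGraph_adj hΘsymm).2 ⟨hne, hne0⟩
  refine ⟨hΘadj, ⟨hΘadj, ?_⟩, ?_, hne0⟩
  · rw [SimpleGraph.isBridge_iff] at hbridge ⊢
    exact fun h => hbridge (h.mono (SimpleGraph.deleteEdges_mono hle))
  · rw [eq_div_iff (sub_pos.2 hminor).ne', hkey]
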